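/- Let $n\ge 1$. For $\lambda>0$ let $h_\lambda(r)=r^n+\lambda r^{n-1}$ for $r>0$ and $h_\lambda(0)=0$, and for $E\subset\mathbb{R}^n$ put $$\mu_\lambda(E)=\inf\Big\{\sum_i h_\lambda(\operatorname{diam} U_i)\;:\;E\subset\bigcup_i U_i\Big\},$$ the infimum being over finite or countable covers of $E$, with no bound on the size of the sets $U_i$; here the covering sets $U_i$ are either arbitrary subsets of $\mathbb{R}^n$, or closed balls of positive radius, or closed axis-parallel cubes of positive side length. A bounded Lipschitz domain is a bounded open set $\Omega\subset\mathbb{R}^n$ (not necessarily connected) such that every $p\in\partial\Omega$ has an open neighbourhood in which, for some unit vector $\nu$ and some Lipschitz function $\gamma:\nu^\perp\to\mathbb{R}$, the set $\Omega$ coincides with $\{x:\gamma(P_{\nu^\perp}x)<\langle \nu,x\rangle\}$, where $P_{\nu^\perp}$ is the orthogonal projection onto $\nu^\perp$. Then there is a constant $C_n\in(0,\infty)$, depending only on $n$, such that for each of these three choices of covering sets, every bounded Lipschitz domain $\Omega\subset\mathbb{R}^n$ and every $\lambda>0$, $$\mu_\lambda(\Omega)\le C_n\big(|\Omega|+\lambda\,\mathcal{H}^{n-1}(\partial\Omega)\big),$$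 where $|\Omega|$ is the Lebesgue measure of $\Omega$ and $\mathcal{H}^{n-1}$ is the $(n-1)$-dimensional Hausdorff measure. -/

import Mathlib

open MeasureTheory
open scoped ENNReal NNReal

noncomputable section

/-- `n`-dimensional Euclidean space. -/
abbrev Euc (n : ℕ) : Type := EuclideanSpace ℝ (Fin n)

/-- An open set `Ω ⊆ ℝⁿ` with Lipschitz boundary: near each boundary point `p` there are a unit
vector `ν` and a Lipschitz function `γ` on the hyperplane orthogonal to `ν` such that `Ω` coincides
near `p` with the open region lying above the graph of `γ` in the direction `ν`.
No connectedness is required. -/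
def IsLipschitzDomain {n : ℕ} (Ω : Set (Euc n)) : Prop :=
  IsOpen Ω ∧ ∀ p ∈ frontier Ω,
    ∃ (ν : Euc n) (U : Set (Euc n)) (K : ℝ≥0) (γ : (Submodule.span ℝ {ν})ᗮ → ℝ),
      ‖ν‖ = 1 ∧ IsOpen U ∧ p ∈ U ∧ LipschitzWith K γ ∧
      ∀ x ∈ U, x ∈ Ω ↔ γ ((Submodule.span ℝ {ν})ᗮ.orthogonalProjectionOnto x) < inner ℝ ν x

/-- The mixed gauge `h(r) = rⁿ + lam * rⁿ⁻¹` for `r > 0`, with `h(0) = 0`. The separate value at `0`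
matters only for `n = 1`, where the second term is `lam` for every `r > 0`. -/
def mixedGauge (n : ℕ) (lam : ℝ) (r : ℝ≥0∞) : ℝ≥0∞ :=
  if r = 0 then 0 else r ^ n + ENNReal.ofReal lam * r ^ (n - 1)

/-- The outer measure that the mixed gauge generates from the class `𝒰` of covering sets:
the infimum of `∑ h(diam U i)` over the finite or countable covers of `E` by members of `𝒰`.
A finite cover appears as a sequence padded with empty sets, which have diameter `0` and cost `0`.
There is no restriction on the size of the covering sets. -/
def mixedMeasure {n : ℕ} (𝒰 : Set (Set (Euc n))) (lam : ℝ) (E : Set (Euc n)) : ℝ≥0∞ :=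
  ⨅ (U : ℕ → Set (Euc n)) (_ : ∀ i, U i = ∅ ∨ U i ∈ 𝒰) (_ : E ⊆ ⋃ i, U i),
    ∑' i, mixedGauge n lam (Metric.ediam (U i))

/-- All closed balls of positive radius. -/
def closedBalls (n : ℕ) : Set (Set (Euc n)) :=
  {U | ∃ (x : Euc n) (r : ℝ), 0 < r ∧ U = Metric.closedBall x r}

/-- All closed axis-parallel cubes of positive side length. -/
def closedCubes (n : ℕ) : Set (Set (Euc n)) :=
  {U | ∃ (a : Euc n) (l : ℝ), 0 < l ∧ U = {x | ∀ i, x i ∈ Set.Icc (a i) (a i + l)}}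

end

/-! In the sup norm, balls are cubes. A small cube about a point of `Ω` lies in `Ω`, while a large
one is mostly outside, as `Ω` has finite volume. Doubling the radius until `Ω` first fills less than
half yields a cube where both `Ω` and its complement keep a fixed share of the volume. The relative
isoperimetric inequality `volume_inter_mul_volume_diff_le` then gives frontier measure at least `c *
r ^ m`, with `m = n - 1`. Vitali selects disjoint cubes of this kind whose fivefold enlargements
cover `Ω`; disjointness bounds the sums of `r ^ n` and `r ^ m` by volume and frontier measure. The
isoperimetric inequality comes from exchanging the coordinates of a point inside and a point outside
one at a time: some exchange crosses the frontier along an axis-parallel segment, so the pair is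
charged to a coordinate projection of the frontier. -/

/-! ### Coordinate exchange in product measures -/

/-- Exchanging some coordinates of two independent points of a product space with factors of
equal mass keeps the distribution. -/
theorem measurePreserving_piecewise_pi {ι : Type*} [Fintype ι] [DecidableEq ι]
    {α : ι → Type*} [∀ i, MeasurableSpace (α i)] (ν : ∀ i, Measure (α i))
    [∀ i, IsFiniteMeasure (ν i)] {M : ℝ≥0∞} (hM0 : M ≠ 0) (hMt : M ≠ ⊤)
    (hν : ∀ i, ν i Set.univ = M) (s : Finset ι) :
    MeasurePreserving (fun p : (∀ i, α i) × (∀ i, α i) => s.piecewise p.2 p.1)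
      ((Measure.pi ν).prod (Measure.pi ν)) (M ^ Fintype.card ι • Measure.pi ν) := by
  have hmeas : Measurable (fun p : (∀ i, α i) × (∀ i, α i) => s.piecewise p.2 p.1) := by
    refine measurable_pi_lambda _ fun i => ?_
    by_cases hi : i ∈ s
    · simp only [Finset.piecewise, hi, if_true]; fun_prop
    · simp only [Finset.piecewise, hi, if_false]; fun_prop
  have hc0 : M ^ Fintype.card ι ≠ 0 := pow_ne_zero _ hM0
  have hct : M ^ Fintype.card ι ≠ ⊤ := ENNReal.pow_ne_top hMt
  refine ⟨hmeas, ?_⟩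
  have key : Measure.pi ν = (M ^ Fintype.card ι)⁻¹ •
      Measure.map (fun p : (∀ i, α i) × (∀ i, α i) => s.piecewise p.2 p.1)
        ((Measure.pi ν).prod (Measure.pi ν)) := by
    refine Measure.pi_eq fun B hB => ?_
    rw [Measure.smul_apply, Measure.map_apply hmeas (MeasurableSet.univ_pi hB)]
    -- Each coordinate is constrained in one factor and free in the other; the free one contributes
    -- `M`.
    have hpre : (fun p : (∀ i, α i) × (∀ i, α i) => s.piecewise p.2 p.1) ⁻¹' Set.pi Set.univ B =
        (Set.pi Set.univ fun i => if i ∈ s then Set.univ else B i) ×ˢ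
          (Set.pi Set.univ fun i => if i ∈ s then B i else Set.univ) := by
      ext p
      simp only [Set.mem_preimage, Set.mem_pi, Set.mem_univ, true_implies, Set.mem_prod,
        ← forall_and]
      refine forall_congr' fun i => ?_
      by_cases hi : i ∈ s <;> simp [Finset.piecewise, hi]
    rw [hpre, Measure.prod_prod, Measure.pi_pi, Measure.pi_pi, ← Finset.prod_mul_distrib]
    have : ∀ i, ν i (if i ∈ s then Set.univ else B i) * ν i (if i ∈ s then B i else Set.univ) =
        M * ν i (B i) := by
      intro i
      by_cases hi : i ∈ s <;> simp [hi, hν, mul_comm]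
    rw [Finset.prod_congr rfl fun i _ => this i, Finset.prod_mul_distrib, Finset.prod_const,
      Finset.card_univ, smul_eq_mul, ← mul_assoc, ENNReal.inv_mul_cancel hc0 hct, one_mul]
  conv_rhs => rw [key]
  rw [smul_smul, ENNReal.mul_inv_cancel hc0 hct, one_smul]

/-- If `A` and `B` are separated in the sense that moving from `A` to `B` along a coordinate
direction is only possible over a small set of lines, then `A` or `B` is small. -/
theorem measure_mul_measure_le_sum_pi {m : ℕ} (ν : Fin (m + 1) → Measure ℝ)
    [∀ i, IsFiniteMeasure (ν i)] {M : ℝ≥0∞} (hM0 : M ≠ 0) (hMt : M ≠ ⊤)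
    (hν : ∀ i, ν i Set.univ = M) (A B : Set (Fin (m + 1) → ℝ))
    (T : Fin (m + 1) → Set (Fin m → ℝ)) (hT : ∀ i, MeasurableSet (T i))
    (Q : Fin (m + 1) → Set ℝ) (hA : A ⊆ Set.pi Set.univ Q) (hB : B = Set.pi Set.univ Q \ A)
    (hsep : ∀ i, ∀ a ∈ A, ∀ b ∈ B, i.removeNth a = i.removeNth b → i.removeNth a ∈ T i) :
    Measure.pi ν A * Measure.pi ν B ≤
      ∑ i, M ^ (m + 2) * Measure.pi (fun j => ν (i.succAbove j)) (T i) := by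
  classical
  -- `z k p` takes its first `k` coordinates from `p.2`, so consecutive points differ in coordinate
  -- `k` only.
  let s : ℕ → Finset (Fin (m + 1)) := fun k => Finset.univ.filter fun j => (j : ℕ) < k
  let z : ℕ → (Fin (m + 1) → ℝ) × (Fin (m + 1) → ℝ) → Fin (m + 1) → ℝ :=
    fun k p => (s k).piecewise p.2 p.1
  have hsub : A ×ˢ B ⊆ ⋃ i : Fin (m + 1), z i ⁻¹' (i.removeNth ⁻¹' T i) := by
    rintro p ⟨hp1, hp2⟩
    have hpQ : p.2 ∈ Set.pi Set.univ Q ∧ p.2 ∉ A := by rw [hB] at hp2; exact hp2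
    have hzQ : ∀ k, z k p ∈ Set.pi Set.univ Q := by
      intro k j _
      by_cases hj : j ∈ s k
      · simpa [z, Finset.piecewise, hj] using hpQ.1 j trivial
      · simpa [z, Finset.piecewise, hj] using hA hp1 j trivial
    have hz0 : z 0 p = p.1 := by
      ext j; simp [z, s]
    have hzlast : z (m + 1) p = p.2 := by
      ext j
      have hj : j ∈ s (m + 1) := by
        simp only [s, Finset.mem_filter, Finset.mem_univ, j.is_lt, and_self]
      simp only [z, Finset.piecewise, hj, if_true]
    have hex : ∃ k, z k p ∉ A := ⟨m + 1, by rw [hzlast]; exact hpQ.2⟩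
    obtain ⟨k, hk⟩ : ∃ k, Nat.find hex = k + 1 := by
      refine Nat.exists_eq_succ_of_ne_zero fun h0 => ?_
      have := Nat.find_spec hex
      rw [h0, hz0] at this
      exact this hp1
    have hkA : z k p ∈ A := by
      by_contra h
      have := Nat.find_min' hex h
      omega
    have hkB : z (k + 1) p ∈ B := by
      rw [hB]
      exact ⟨hzQ _, hk ▸ Nat.find_spec hex⟩
    have hkm : k < m + 1 := by
      have := Nat.find_min' hex (m := m + 1) (by rw [hzlast]; exact hpQ.2)
      omega
    refine Set.mem_iUnion.2 ⟨⟨k, hkm⟩, hsep ⟨k, hkm⟩ _ hkA _ hkB ?_⟩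
    ext j
    have hne : (((⟨k, hkm⟩ : Fin (m + 1)).succAbove j : Fin (m + 1)) : ℕ) ≠ k := fun h =>
      Fin.succAbove_ne ⟨k, hkm⟩ j (Fin.ext h)
    have hiff : ((⟨k, hkm⟩ : Fin (m + 1)).succAbove j ∈ s k) ↔
        ((⟨k, hkm⟩ : Fin (m + 1)).succAbove j ∈ s (k + 1)) := by
      simp only [s, Finset.mem_filter, Finset.mem_univ, true_and]
      omega
    simp only [Fin.removeNth, z, Finset.piecewise, hiff]
  have hmeas : ∀ i : Fin (m + 1), MeasurableSet (i.removeNth ⁻¹' T i : Set (Fin (m + 1) → ℝ)) := by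
    intro i
    have : Measurable (fun f : Fin (m + 1) → ℝ => i.removeNth f) :=
      measurable_pi_lambda _ fun j => by simp only [Fin.removeNth]; fun_prop
    exact this (hT i)
  rw [← Measure.prod_prod]
  refine (measure_mono hsub).trans ((measure_iUnion_fintype_le _ _).trans
    (Finset.sum_le_sum fun i _ => ?_))
  rw [(measurePreserving_piecewise_pi ν hM0 hMt hν (s i)).measure_preimage
    (hmeas i).nullMeasurableSet, Measure.smul_apply, smul_eq_mul, Fintype.card_fin]
  -- Coordinate `i` is free, which adds one more factor `M` to `M ^ (m + 1)`.
  have hpre : (i.removeNth ⁻¹' T i : Set (Fin (m + 1) → ℝ)) =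
      MeasurableEquiv.piFinSuccAbove (fun _ => ℝ) i ⁻¹' (Set.univ ×ˢ T i) := by
    ext f
    simp [MeasurableEquiv.piFinSuccAbove, Fin.insertNthEquiv]
  rw [hpre, (measurePreserving_piFinSuccAbove ν i).measure_preimage
    (MeasurableSet.univ.prod (hT i)).nullMeasurableSet, Measure.prod_prod, hν, ← mul_assoc,
    ← pow_succ]

/-! ### Relative isoperimetric inequality -/

/-- A preconnected set that meets a set and its complement meets the frontier. -/
theorem IsPreconnected.nonempty_inter_frontier {X : Type*} [TopologicalSpace X] {s u : Set X}
    (hs : IsPreconnected s) (h1 : (s ∩ u).Nonempty) (h2 : (s ∩ uᶜ).Nonempty) :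
    (s ∩ frontier u).Nonempty := by
  by_contra hne
  rw [Set.not_nonempty_iff_eq_empty] at hne
  have hfr : ∀ w ∈ s, w ∉ frontier u := fun w hw hwu =>
    Set.eq_empty_iff_forall_notMem.1 hne w ⟨hw, hwu⟩
  obtain ⟨a, has, hau⟩ := h1
  obtain ⟨b, hbs, hbu⟩ := h2
  have ha : a ∈ interior u := by
    by_contra h
    exact hfr a has ⟨subset_closure hau, h⟩
  have hb : b ∈ (closure u)ᶜ := fun h => hfr b hbs ⟨h, fun h' => hbu (interior_subset h')⟩
  obtain ⟨w, -, hw1, hw2⟩ := hs (interior u) (closure u)ᶜ isOpen_interior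
    isClosed_closure.isOpen_compl (fun w hw => by
      by_cases h : w ∈ interior u
      · exact Or.inl h
      · exact Or.inr fun h' => hfr w hw ⟨h', h⟩) ⟨a, has, ha⟩ ⟨b, hbs, hb⟩
  exact hw2 (subset_closure (interior_subset hw1))

/-- A relative isoperimetric inequality in a cube. -/
theorem volume_inter_mul_volume_diff_le {m : ℕ} {Ω : Set (Fin (m + 1) → ℝ)}
    (x : Fin (m + 1) → ℝ) {r : ℝ} (hr : 0 < r) :
    volume (Ω ∩ Metric.closedBall x r) * volume (Metric.closedBall x r \ Ω) ≤
      (m + 1 : ℕ) * (ENNReal.ofReal (2 * r) ^ (m + 2) *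
        Measure.hausdorffMeasure (m : ℝ) (frontier Ω ∩ Metric.closedBall x r)) := by
  set M := ENNReal.ofReal (2 * r)
  let Q : Fin (m + 1) → Set ℝ := fun i => Metric.closedBall (x i) r
  have hQ : Metric.closedBall x r = Set.pi Set.univ Q := closedBall_pi x hr.le
  let ν : Fin (m + 1) → Measure ℝ := fun i => volume.restrict (Q i)
  have hν : ∀ i, ν i Set.univ = M := fun i => by simp [ν, Q, M]
  have hfin : ∀ i, IsFiniteMeasure (ν i) := fun i => ⟨by rw [hν]; exact ENNReal.ofReal_lt_top⟩
  have hpi : Measure.pi ν = volume.restrict (Metric.closedBall x r) := by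
    rw [hQ, volume_pi, Measure.restrict_pi_pi]
  let T : Fin (m + 1) → Set (Fin m → ℝ) := fun i =>
    (fun f : Fin (m + 1) → ℝ => i.removeNth f) '' (frontier Ω ∩ Metric.closedBall x r)
  have hlip : ∀ i : Fin (m + 1), LipschitzWith 1 (fun f : Fin (m + 1) → ℝ => i.removeNth f) :=
    fun i => LipschitzWith.of_dist_le_mul fun f g => by
      rw [NNReal.coe_one, one_mul, dist_pi_le_iff dist_nonneg]
      exact fun j => dist_le_pi_dist f g _
  have hTc : ∀ i, IsCompact (T i) := fun i =>
    ((isCompact_closedBall x r).inter_left isClosed_frontier).image (hlip i).continuous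
  have hmain := measure_mul_measure_le_sum_pi ν (by simpa [M] using hr) ENNReal.ofReal_ne_top hν
    (Ω ∩ Metric.closedBall x r) (Metric.closedBall x r \ Ω) T (fun i => (hTc i).measurableSet) Q
    (hQ ▸ Set.inter_subset_right) (by rw [← hQ]; ext; simp) (by
      rintro i a ⟨ha, haQ⟩ b ⟨hbQ, hb⟩ hab
      -- The segment is parallel to axis `i`, so the frontier point on it has the same projection as
      -- `a`.
      obtain ⟨w, hw, hwΩ⟩ := (convex_segment a b).isPreconnected.nonempty_inter_frontier
        (u := Ω) ⟨a, left_mem_segment ℝ a b, ha⟩ ⟨b, right_mem_segment ℝ a b, hb⟩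
      refine ⟨w, ⟨hwΩ, (convex_closedBall x r).segment_subset haQ hbQ hw⟩, ?_⟩
      obtain ⟨s, t, hs, ht, hst, rfl⟩ := hw
      ext j
      have hj : a (i.succAbove j) = b (i.succAbove j) := congrFun hab j
      simp only [Fin.removeNth, Pi.add_apply, Pi.smul_apply, smul_eq_mul, ← hj, ← add_mul, hst,
        one_mul])
  rw [hpi, Measure.restrict_eq_self _ Set.inter_subset_right,
    Measure.restrict_eq_self _ Set.sdiff_subset] at hmain
  refine hmain.trans ?_
  have hle : ∀ i : Fin (m + 1), M ^ (m + 2) * Measure.pi (fun j => ν (i.succAbove j)) (T i) ≤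
      M ^ (m + 2) * Measure.hausdorffMeasure (m : ℝ) (frontier Ω ∩ Metric.closedBall x r) := by
    intro i
    gcongr
    calc Measure.pi (fun j => ν (i.succAbove j)) (T i) ≤ volume (T i) := by
          rw [← Measure.restrict_pi_pi (fun _ => volume)]
          exact Measure.restrict_apply_le _ _
      _ = Measure.hausdorffMeasure (m : ℝ) (T i) := by
          rw [← hausdorffMeasure_pi_real, Fintype.card_fin]
      _ ≤ _ := by
          simpa using (hlip i).hausdorffMeasure_image_le (d := (m : ℝ)) m.cast_nonneg
            (frontier Ω ∩ Metric.closedBall x r)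
  refine (Finset.sum_le_sum fun i _ => hle i).trans ?_
  simp

/-! ### Critical radii and the Vitali cover -/

theorem volume_closedBall_eq_pow {m : ℕ} (x : Fin (m + 1) → ℝ) {r : ℝ} (hr : 0 ≤ r) :
    volume (Metric.closedBall x r) = (2 * ENNReal.ofReal r) ^ (m + 1) := by
  rw [Real.volume_pi_closedBall x hr, Fintype.card_fin, ENNReal.ofReal_pow (by positivity),
    ENNReal.ofReal_mul (by norm_num), ENNReal.ofReal_ofNat]

/-- Around each point of an open set of finite volume there is a cube that captures a fixed
proportion of both volume and boundary. -/
theorem exists_radius_volume_frontier {m : ℕ} {Ω : Set (Fin (m + 1) → ℝ)} (hΩ : IsOpen Ω)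
    (hfin : volume Ω ≠ ⊤) {x : Fin (m + 1) → ℝ} (hx : x ∈ Ω) :
    ∃ r : ℝ, 0 < r ∧
      ENNReal.ofReal r ^ (m + 1) ≤ 2 * volume (Ω ∩ Metric.closedBall x r) ∧
      ENNReal.ofReal r ^ m ≤ (8 * (m + 1 : ℕ)) *
        Measure.hausdorffMeasure (m : ℝ) (frontier Ω ∩ Metric.closedBall x r) := by
  classical
  obtain ⟨r₀, hr₀, hsub⟩ := Metric.nhds_basis_closedBall.mem_iff.1 (hΩ.mem_nhds hx)
  let ρ : ℕ → ℝ := fun k => r₀ * 2 ^ k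
  have hρ : ∀ k, 0 < ρ k := fun k => by positivity
  have hex : ∃ k, 2 * volume (Ω ∩ Metric.closedBall x (ρ k)) <
      volume (Metric.closedBall x (ρ k)) := by
    obtain ⟨k, hk⟩ := pow_unbounded_of_one_lt (((2 * volume Ω).toReal + 1) / r₀) one_lt_two
    have hk' : (2 * volume Ω).toReal + 1 < ρ k := by
      rw [div_lt_iff₀ hr₀] at hk
      simpa [ρ, mul_comm] using hk
    have h1 : 1 ≤ ρ k := by linarith [ENNReal.toReal_nonneg (a := 2 * volume Ω)]
    refine ⟨k, lt_of_le_of_lt (mul_le_mul_right (measure_mono Set.inter_subset_left) 2) ?_⟩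
    have hlt : 2 * volume Ω < ENNReal.ofReal (ρ k) := by
      rw [ENNReal.lt_ofReal_iff_toReal_lt (ENNReal.mul_ne_top (by norm_num) hfin)]
      linarith
    refine hlt.trans_le ?_
    rw [volume_closedBall_eq_pow x (hρ k).le]
    have hone : 1 ≤ ENNReal.ofReal (ρ k) := ENNReal.one_le_ofReal.2 h1
    have h2 : ENNReal.ofReal (ρ k) ≤ 2 * ENNReal.ofReal (ρ k) := by
      rw [two_mul]; exact le_self_add
    exact h2.trans (le_self_pow (hone.trans h2) (by omega))
  obtain ⟨k, hk⟩ : ∃ k, Nat.find hex = k + 1 := by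
    refine Nat.exists_eq_succ_of_ne_zero fun h0 => ?_
    have := Nat.find_spec hex
    rw [h0, Set.inter_eq_self_of_subset_right (by simpa [ρ] using hsub), two_mul] at this
    exact absurd this (not_lt.2 le_self_add)
  have hk1 := Nat.find_spec hex
  rw [hk] at hk1
  have hk0 : volume (Metric.closedBall x (ρ k)) ≤ 2 * volume (Ω ∩ Metric.closedBall x (ρ k)) :=
    not_lt.1 (Nat.find_min hex (by omega))
  have hρs : ρ (k + 1) = 2 * ρ k := by simp only [ρ]; ring
  -- The cube of radius `ρ k` has side `ρ (k + 1)`, and `Ω` still fills at least half of it.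
  have hA : ENNReal.ofReal (ρ (k + 1)) ^ (m + 1) ≤
      2 * volume (Ω ∩ Metric.closedBall x (ρ (k + 1))) := by
    rw [volume_closedBall_eq_pow x (hρ k).le] at hk0
    calc ENNReal.ofReal (ρ (k + 1)) ^ (m + 1) = (2 * ENNReal.ofReal (ρ k)) ^ (m + 1) := by
          rw [hρs, ENNReal.ofReal_mul (by norm_num), ENNReal.ofReal_ofNat]
      _ ≤ _ := hk0
      _ ≤ _ := by
          gcongr
          linarith [hρ k]
  refine ⟨ρ (k + 1), hρ _, hA, ?_⟩
  have hiso := volume_inter_mul_volume_diff_le (Ω := Ω) x (hρ (k + 1))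
  have hsplit : volume (Ω ∩ Metric.closedBall x (ρ (k + 1))) +
      volume (Metric.closedBall x (ρ (k + 1)) \ Ω) =
        volume (Metric.closedBall x (ρ (k + 1))) := by
    rw [Set.inter_comm]
    exact measure_inter_add_sdiff _ hΩ.measurableSet
  have hafin : volume (Ω ∩ Metric.closedBall x (ρ (k + 1))) ≠ ⊤ :=
    measure_ne_top_of_subset Set.inter_subset_left hfin
  rw [ENNReal.ofReal_mul (by norm_num), ENNReal.ofReal_ofNat] at hiso
  rw [← hsplit, two_mul] at hk1
  have hab := (ENNReal.add_lt_add_iff_left hafin).1 hk1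
  rw [volume_closedBall_eq_pow x (hρ _).le] at hsplit
  set R := ENNReal.ofReal (ρ (k + 1)) with hR
  set a := volume (Ω ∩ Metric.closedBall x (ρ (k + 1)))
  set b := volume (Metric.closedBall x (ρ (k + 1)) \ Ω)
  set H := Measure.hausdorffMeasure (m : ℝ) (frontier Ω ∩ Metric.closedBall x (ρ (k + 1)))
  have hR0 : R ≠ 0 := by simpa [hR] using hρ (k + 1)
  have hRt : R ≠ ⊤ := ENNReal.ofReal_ne_top
  have hB : (2 * R) ^ (m + 1) ≤ 2 * b := by
    rw [← hsplit, two_mul]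
    gcongr
  -- The 8 is `2 * 2` from the two half-volume bounds, times the 2 in the surplus factor `2 * R`.
  have hprod : (R * (2 * R) ^ (m + 1)) * R ^ m ≤
      (R * (2 * R) ^ (m + 1)) * (8 * (m + 1 : ℕ) * H) := by
    calc (R * (2 * R) ^ (m + 1)) * R ^ m = R ^ (m + 1) * (2 * R) ^ (m + 1) := by ring
      _ ≤ (2 * a) * (2 * b) := mul_le_mul' hA hB
      _ = 4 * (a * b) := by ring
      _ ≤ 4 * ((m + 1 : ℕ) * ((2 * R) ^ (m + 2) * H)) := by gcongr
      _ = _ := by ring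
  have h2R0 : (2 * R) ^ (m + 1) ≠ 0 := pow_ne_zero _ (mul_ne_zero two_ne_zero hR0)
  have h2Rt : (2 * R) ^ (m + 1) ≠ ⊤ := ENNReal.pow_ne_top (ENNReal.mul_ne_top (by norm_num) hRt)
  exact (ENNReal.mul_le_mul_iff_right (mul_ne_zero hR0 h2R0) (ENNReal.mul_ne_top hRt h2Rt)).1 hprod

/-- An open set of finite volume has a countable cover by cubes whose total content is controlled
by its volume and the Hausdorff measure of its frontier. -/
theorem exists_cover_closedBall_volume_frontier {m : ℕ} {Ω : Set (Fin (m + 1) → ℝ)}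
    (hΩ : IsOpen Ω) (hfin : volume Ω ≠ ⊤) :
    ∃ (u : Set (Fin (m + 1) → ℝ)) (r : (Fin (m + 1) → ℝ) → ℝ), u.Countable ∧
      (∀ a ∈ u, 0 < r a) ∧ Ω ⊆ ⋃ a : u, Metric.closedBall a.1 (5 * r a) ∧
      ∑' a : u, ENNReal.ofReal (r a) ^ (m + 1) ≤ 2 * volume Ω ∧
      ∑' a : u, ENNReal.ofReal (r a) ^ m ≤
        (8 * (m + 1 : ℕ)) * Measure.hausdorffMeasure (m : ℝ) (frontier Ω) := by
  choose! r hr hvol hfr using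
    fun (x : Fin (m + 1) → ℝ) (hx : x ∈ Ω) => exists_radius_volume_frontier hΩ hfin hx
  -- Vitali needs uniformly bounded radii; for `r a ≥ 1` the volume bound supplies this.
  have hbound : ∀ a ∈ Ω, r a ≤ max 1 (2 * volume Ω).toReal := by
    intro a ha
    rcases le_total (r a) 1 with h | h
    · exact h.trans (le_max_left _ _)
    · refine le_trans ?_ (le_max_right _ _)
      rw [← ENNReal.ofReal_le_iff_le_toReal (ENNReal.mul_ne_top (by norm_num) hfin)]
      calc ENNReal.ofReal (r a) ≤ ENNReal.ofReal (r a) ^ (m + 1) :=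
            le_self_pow (ENNReal.one_le_ofReal.2 h) (by omega)
        _ ≤ _ := hvol a ha
        _ ≤ _ := by
            gcongr
            exact Set.inter_subset_left
  obtain ⟨u, huΩ, hdisj, hcov⟩ := Vitali.exists_disjoint_subfamily_covering_enlargement_closedBall
    Ω id r _ hbound 5 (by norm_num)
  have hcount : u.Countable := hdisj.countable_of_nonempty_interior fun a ha =>
    ((Metric.nonempty_ball (x := a)).2 (hr a (huΩ ha))).mono Metric.ball_subset_interior_closedBall
  have : Countable u := hcount.to_subtype
  have hsum : ∀ (μ : Measure (Fin (m + 1) → ℝ)) (S : Set (Fin (m + 1) → ℝ)), MeasurableSet S →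
      ∑' a : u, μ (S ∩ Metric.closedBall a.1 (r a)) ≤ μ S := by
    intro μ S hS
    rw [← measure_iUnion (fun a b hab => ?_)
      fun a => hS.inter Metric.isClosed_closedBall.measurableSet]
    · exact measure_mono (Set.iUnion_subset fun a => Set.inter_subset_left)
    · exact (hdisj a.2 b.2 (Subtype.coe_ne_coe.2 hab)).mono Set.inter_subset_right
        Set.inter_subset_right
  refine ⟨u, r, hcount, fun a ha => hr a (huΩ ha), ?_, ?_, ?_⟩
  · intro x hx
    obtain ⟨b, hb, hsub⟩ := hcov x hx
    exact Set.mem_iUnion.2 ⟨⟨b, hb⟩, hsub (Metric.mem_closedBall_self (hr x hx).le)⟩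
  · refine (ENNReal.tsum_le_tsum fun a : u => hvol a (huΩ a.2)).trans ?_
    rw [ENNReal.tsum_mul_left]
    gcongr
    exact hsum _ _ hΩ.measurableSet
  · refine (ENNReal.tsum_le_tsum fun a : u => hfr a (huΩ a.2)).trans ?_
    rw [ENNReal.tsum_mul_left]
    gcongr
    exact hsum _ _ isClosed_frontier.measurableSet

/-! ### Admissible covers and return to the Euclidean norm -/

theorem mixedGauge_le {n : ℕ} {lam : ℝ} {r R : ℝ≥0∞} (h : r ≤ R) :
    mixedGauge n lam r ≤ R ^ n + ENNReal.ofReal lam * R ^ (n - 1) := by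
  unfold mixedGauge
  split_ifs
  · exact zero_le
  · gcongr

/-- A countably indexed cover bounds the mixed measure. -/
theorem mixedMeasure_le_tsum {n : ℕ} {𝒰 : Set (Set (Euc n))} {lam : ℝ} {E : Set (Euc n)}
    {ι : Type*} [Countable ι] (V : ι → Set (Euc n)) (hV : ∀ a, V a ∈ 𝒰) (hE : E ⊆ ⋃ a, V a) :
    mixedMeasure 𝒰 lam E ≤ ∑' a, mixedGauge n lam (Metric.ediam (V a)) := by
  have := Encodable.ofCountable ι
  have hcases : ∀ i : ℕ, (⋃ a ∈ Encodable.decode₂ ι i, V a) = ∅ ∨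
      (⋃ a ∈ Encodable.decode₂ ι i, V a) ∈ 𝒰 := fun i =>
    Encodable.iUnion_decode₂_cases (C := fun S => S = ∅ ∨ S ∈ 𝒰) (Or.inl rfl)
      fun a => Or.inr (hV a)
  rw [← tsum_iUnion_decode₂ (fun S => mixedGauge n lam (Metric.ediam S)) (by simp [mixedGauge])]
  exact iInf_le_of_le _ (iInf_le_of_le hcases
    (iInf_le_of_le (by rwa [Encodable.iUnion_decode₂]) le_rfl))

theorem exists_dist_le_mul_dist_ofLp (n : ℕ) :
    ∃ D : ℝ≥0, 0 < D ∧ ∀ x y : Euc n, dist x y ≤ D * dist (WithLp.ofLp x) (WithLp.ofLp y) := by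
  obtain ⟨K, hK⟩ : ∃ K, AntilipschitzWith K (WithLp.ofLp : Euc n → Fin n → ℝ) :=
    ⟨_, PiLp.antilipschitzWith_ofLp 2 fun _ : Fin n => ℝ⟩
  refine ⟨K + 1, by positivity, fun x y => (hK.le_mul_dist x y).trans ?_⟩
  gcongr
  exact le_self_add

/-- Each class of covering sets contains a set that encloses a given cube and has comparable
diameter. -/
theorem exists_mem_superset_ediam_le {n : ℕ} {𝒰 : Set (Set (Euc n))}
    (h𝒰 : 𝒰 = Set.univ ∨ 𝒰 = closedBalls n ∨ 𝒰 = closedCubes n) {D : ℝ≥0} (hD : 0 < D)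
    (hdist : ∀ x y : Euc n, dist x y ≤ D * dist (WithLp.ofLp x) (WithLp.ofLp y))
    (a : Fin n → ℝ) {r : ℝ} (hr : 0 < r) :
    ∃ U ∈ 𝒰, WithLp.ofLp ⁻¹' Metric.closedBall a r ⊆ U ∧
      Metric.ediam U ≤ 2 * D * ENNReal.ofReal r := by
  have hDr : (2 * D * ENNReal.ofReal r : ℝ≥0∞) = ENNReal.ofReal (2 * (D * r)) := by
    rw [ENNReal.ofReal_mul (by norm_num), ENNReal.ofReal_mul D.coe_nonneg, ENNReal.ofReal_ofNat,
      ENNReal.ofReal_coe_nnreal, mul_assoc]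
  have hball : ∃ U ∈ closedBalls n, WithLp.ofLp ⁻¹' Metric.closedBall a r ⊆ U ∧
      Metric.ediam U ≤ 2 * D * ENNReal.ofReal r := by
    have hDr0 : 0 < D * r := mul_pos (NNReal.coe_pos.2 hD) hr
    refine ⟨_, ⟨WithLp.toLp 2 a, D * r, hDr0, rfl⟩, fun y hy => ?_, ?_⟩
    · refine (hdist _ _).trans ?_
      gcongr
      exact hy
    · rw [hDr]
      refine Metric.ediam_le fun y hy z hz => ?_
      rw [edist_dist]
      refine ENNReal.ofReal_le_ofReal ((dist_triangle_right _ _ (WithLp.toLp 2 a)).trans ?_)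
      rw [two_mul]
      exact add_le_add hy hz
  rcases h𝒰 with rfl | rfl | rfl
  · obtain ⟨U, -, hU⟩ := hball
    exact ⟨U, trivial, hU⟩
  · exact hball
  · have hcube : {x : Euc n | ∀ i, x i ∈ Set.Icc (WithLp.toLp 2 (fun i => a i - r) i)
        (WithLp.toLp 2 (fun i => a i - r) i + 2 * r)} = WithLp.ofLp ⁻¹' Metric.closedBall a r := by
      ext y
      simp only [Set.mem_ofPred_eq, Set.mem_preimage, Metric.mem_closedBall,
        dist_pi_le_iff hr.le, Real.dist_eq, abs_le, Set.mem_Icc]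
      refine forall_congr' fun i => ?_
      constructor <;> rintro ⟨h1, h2⟩ <;> constructor <;> linarith
    refine ⟨_, ⟨WithLp.toLp 2 fun i => a i - r, 2 * r, by positivity, rfl⟩, hcube.ge, ?_⟩
    rw [hcube, hDr]
    refine Metric.ediam_le fun y hy z hz => ?_
    rw [edist_dist]
    refine ENNReal.ofReal_le_ofReal ((hdist _ _).trans ?_)
    have : dist (WithLp.ofLp y) (WithLp.ofLp z) ≤ 2 * r := by
      rw [two_mul]
      exact (dist_triangle_right _ _ a).trans (add_le_add hy hz)
    calc (D : ℝ) * dist (WithLp.ofLp y) (WithLp.ofLp z) ≤ D * (2 * r) := by gcongr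
      _ = 2 * (D * r) := by ring

/-- The bound for every bounded open set. -/
theorem exists_mixedMeasure_le_of_isOpen (m : ℕ) :
    ∃ C : ℝ≥0, 0 < C ∧
      ∀ 𝒰 : Set (Set (Euc (m + 1))),
        (𝒰 = Set.univ ∨ 𝒰 = closedBalls (m + 1) ∨ 𝒰 = closedCubes (m + 1)) →
        ∀ Ω : Set (Euc (m + 1)), Bornology.IsBounded Ω → IsOpen Ω → ∀ lam : ℝ,
          mixedMeasure 𝒰 lam Ω ≤
            (C : ℝ≥0∞) * ((volume : Measure (Euc (m + 1))) Ω + ENNReal.ofReal lam *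
              (Measure.hausdorffMeasure (m : ℝ) : Measure (Euc (m + 1))) (frontier Ω)) := by
  obtain ⟨D, hD, hdist⟩ := exists_dist_le_mul_dist_ofLp (m + 1)
  -- The diameters are at most `2 * D * (5 * r)`; the sum of the volume and frontier constants
  -- serves both terms.
  refine ⟨2 * (10 * D) ^ (m + 1) + 8 * (m + 1 : ℕ) * (10 * D) ^ m, by positivity,
    fun 𝒰 h𝒰 Ω hbdd hΩ lam => ?_⟩
  let e : Euc (m + 1) ≃ₜ (Fin (m + 1) → ℝ) := PiLp.homeomorph 2 fun _ => ℝ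
  have he : ∀ x, e x = WithLp.ofLp x := fun _ => rfl
  have hvol : volume (e '' Ω) = volume Ω := by
    rw [e.image_eq_preimage_symm]
    exact (PiLp.volume_preserving_toLp (Fin (m + 1))).measure_preimage
      hΩ.measurableSet.nullMeasurableSet
  -- The sup norm is at most the Euclidean norm, so Hausdorff measure does not increase.
  have hfr : Measure.hausdorffMeasure (m : ℝ) (frontier (e '' Ω)) ≤
      Measure.hausdorffMeasure (m : ℝ) (frontier Ω) := by
    rw [← e.image_frontier]
    simpa [e, PiLp.homeomorph] using (PiLp.lipschitzWith_ofLp 2 fun _ : Fin (m + 1) => ℝ).hausdorffMeasure_image_le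
      (d := (m : ℝ)) m.cast_nonneg (frontier Ω)
  obtain ⟨u, r, hu, hr, hcov, hsum1, hsum2⟩ := exists_cover_closedBall_volume_frontier
    (e.isOpenMap _ hΩ) (hvol ▸ hbdd.measure_lt_top.ne)
  rw [hvol] at hsum1
  have hsum2' := hsum2.trans (mul_le_mul_right hfr _)
  have : Countable u := hu.to_subtype
  choose V hV𝒰 hVsub hVdiam using fun a : u =>
    exists_mem_superset_ediam_le h𝒰 hD hdist a.1 (mul_pos (by norm_num : (0 : ℝ) < 5) (hr _ a.2))
  have hcovV : Ω ⊆ ⋃ a, V a := by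
    intro x hx
    obtain ⟨a, ha⟩ := Set.mem_iUnion.1 (hcov (Set.mem_image_of_mem e hx))
    exact Set.mem_iUnion.2 ⟨a, hVsub a ha⟩
  have hterm : ∀ a : u, mixedGauge (m + 1) lam (Metric.ediam (V a)) ≤
      (10 * D) ^ (m + 1) * ENNReal.ofReal (r a) ^ (m + 1) +
        ENNReal.ofReal lam * (10 * D) ^ m * ENNReal.ofReal (r a) ^ m := by
    intro a
    refine (mixedGauge_le (hVdiam a)).trans (le_of_eq ?_)
    rw [ENNReal.ofReal_mul (by norm_num), ENNReal.ofReal_ofNat, Nat.add_sub_cancel,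
      show (2 * D * (5 * ENNReal.ofReal (r a)) : ℝ≥0∞) = 10 * D * ENNReal.ofReal (r a) by ring,
      mul_pow, mul_pow _ _ m, mul_assoc (ENNReal.ofReal lam)]
  refine (mixedMeasure_le_tsum V hV𝒰 hcovV).trans ((ENNReal.tsum_le_tsum hterm).trans ?_)
  rw [ENNReal.tsum_add, ENNReal.tsum_mul_left, ENNReal.tsum_mul_left]
  push_cast
  push_cast at hsum2'
  set v := volume Ω
  set H := Measure.hausdorffMeasure (m : ℝ) (frontier Ω)
  calc _ ≤ (10 * D : ℝ≥0∞) ^ (m + 1) * (2 * v) +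
        ENNReal.ofReal lam * (10 * D) ^ m * (8 * (m + 1) * H) := by gcongr
    _ = 2 * (10 * D : ℝ≥0∞) ^ (m + 1) * v +
        8 * (m + 1) * (10 * D) ^ m * (ENNReal.ofReal lam * H) := by ring
    _ ≤ (2 * (10 * D : ℝ≥0∞) ^ (m + 1) + 8 * (m + 1) * (10 * D) ^ m) * v +
        (2 * (10 * D : ℝ≥0∞) ^ (m + 1) + 8 * (m + 1) * (10 * D) ^ m) *
          (ENNReal.ofReal lam * H) := by
        gcongr
        · exact le_self_add
        · exact le_add_self
    _ = _ := by ring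

/-- The volume is Lebesgue measure, `μH[n - 1]` is Hausdorff measure, and the bound holds whether
the covering sets are arbitrary sets, balls, or cubes. -/
theorem theorem4p1 (n : ℕ) (hn : 1 ≤ n) :
    ∃ C : ℝ≥0, 0 < C ∧
      ∀ 𝒰 : Set (Set (Euc n)), (𝒰 = Set.univ ∨ 𝒰 = closedBalls n ∨ 𝒰 = closedCubes n) →
        ∀ Ω : Set (Euc n), Bornology.IsBounded Ω → IsLipschitzDomain Ω →
          ∀ lam : ℝ, 0 < lam →
            mixedMeasure 𝒰 lam Ω ≤
              (C : ℝ≥0∞) * ((volume : Measure (Euc n)) Ω +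
                ENNReal.ofReal lam *
                  (Measure.hausdorffMeasure ((n : ℝ) - 1) : Measure (Euc n)) (frontier Ω)) := by
  obtain ⟨m, rfl⟩ := Nat.exists_eq_succ_of_ne_zero (Nat.one_le_iff_ne_zero.1 hn)
  obtain ⟨C, hC, h⟩ := exists_mixedMeasure_le_of_isOpen m
  refine ⟨C, hC, fun 𝒰 h𝒰 Ω hbdd hΩ lam _ => ?_⟩
  rw [show (((m.succ : ℕ) : ℝ) - 1) = m by push_cast; ring]
  exact h 𝒰 h𝒰 Ω hbdd hΩ.1 lam
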